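/- **Graphs.** Let $[N]=\{1,\dots,N\}$ and let $\log$ denote the logarithm to base $2$. For a function $r$ from $[N]$ to the non-negative integers, let $G_r$ be the directed acyclic graph on $[N]$ with the edges $(i,i+1)$ for $1\le i<N$ and the edges $(r(i),i)$ for all $i\in[N]$ with $1\le r(i)<i$. A *random Argon2i-A graph* on $[N]$ is $G_r$ with independent values $r(i)$, where $r(i)$ is uniform on $\{1,\dots,i-2\}$ for $i\ge 3$, and there is no edge $(r(i),i)$ for $i\le 2$. A *random Argon2i-B graph* on $[N]$ is $G_r$ with independent values $r(i)$ distributed by $$\Pr[r(i)=j]=\Pr_{x}\left[\,i\left(1-\tfrac{x^2}{N^2}\right)\in(j-1,j]\,\right],\qquad x \text{ uniform on } [N],\quad j=0,1,\dots,i,$$ where the outcomes $r(i)=0$ and $r(i)=i$ give no edge. **Quantum pebbling.** For a directed acyclic graph $G=(V,E)$ and $W\subseteq V$, let $\mathrm{parents}(W)=\{u:(u,w)\in E\text{ for some }w\in W\}$, and let $\mathrm{sinks}(G)$ be the set of nodes without outgoing edges. A legal parallel quantum pebbling of $G$ is a sequence $P=(P_0,\dots,P_t)$ of subsets of $V$ with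 $P_0=\varnothing$ and $P_t=\mathrm{sinks}(G)$ such that for each $1\le i\le t$ $$\mathrm{parents}(P_i\setminus P_{i-1})\cup\mathrm{parents}(P_{i-1}\setminus P_i)\subseteq P_{i-1}\cap P_i .$$ Its space-time cost is $t\cdot\max_{1\le i\le t}|P_i|$, and the parallel quantum space-time complexity $\Pi_{st}(G)$ is the minimum of this cost over all legal parallel quantum pebblings of $G$. **Statement.** There is an absolute constant $C>0$ such that, with high probability, a random Argon2i-A graph $G_A$ on $[N]$ and a random Argon2i-B graph $G_B$ on $[N]$ satisfy $$\Pi_{st}(G_A)\le C\,\frac{N^2\log\log N}{\sqrt{\log N}}\qquad\text{and}\qquad \Pi_{st}(G_B)\le C\,\frac{N^2}{\sqrt[3]{\log N}},$$ respectively. Here "with high probability" means: for every $c>0$, each of the two bounds holds with probability at least $1-N^{-c}$ for all sufficiently large $N$. -/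

import Mathlib

open Filter MeasureTheory
open scoped ENNReal

noncomputable section

namespace QuantumPebbling

/-! ### The parallel quantum pebbling game -/

section Game

variable {V : Type*}

/-- The parents of a set `W` of nodes: all `u` with an edge `(u, w)`, `w ∈ W`. -/
def parents (G : Digraph V) (W : Set V) : Set V :=
  {u | ∃ w ∈ W, G.Adj u w}

/-- The nodes without outgoing edges. -/
def sinks (G : Digraph V) : Set V :=
  {v | ¬ ∃ u, G.Adj v u}

/-- A legal parallel quantum pebbling `(P₀, …, P_t)` of the target set `T`. The values `conf i`
with `i > time` play no role. -/
structure Pebbling (G : Digraph V) (T : Set V) where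
  /-- The number `t` of rounds. -/
  time : ℕ
  /-- The configurations `P i`. -/
  conf : ℕ → Finset V
  start : conf 0 = ∅
  /-- The pebbling ends with pebbles exactly on the target nodes. -/
  finish : (conf time : Set V) = T
  /-- A pebble is added only if all its parents were pebbled in the previous round. -/
  add_legal : ∀ i < time, ∀ x ∈ (conf (i + 1) : Set V) \ conf i,
    parents G {x} ⊆ conf i
  /-- No-deletion: a pebble is removed only if all its parents were pebbled in the previous
  round. -/
  delete_legal : ∀ i < time, ∀ x ∈ (conf i : Set V) \ conf (i + 1),
    parents G {x} ⊆ conf i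
  /-- Reversibility: pebbles that were used to add or remove pebbles are kept. -/
  reversible : ∀ i < time,
    parents G ((conf (i + 1) : Set V) \ conf i) ∪ parents G ((conf i : Set V) \ conf (i + 1))
      ⊆ conf (i + 1)

/-- The space cost `max_{1 ≤ i ≤ t} |P_i|`. -/
def Pebbling.space {G : Digraph V} {T : Set V} (P : Pebbling G T) : ℕ :=
  (Finset.Icc 1 P.time).sup fun i => (P.conf i).card

/-- The space-time cost: number of rounds times space. -/
def Pebbling.spaceTime {G : Digraph V} {T : Set V} (P : Pebbling G T) : ℕ :=
  P.time * P.space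

/-- The parallel quantum space-time complexity of `G`: the least space-time cost of a legal parallel
quantum pebbling of the sinks of `G` (`⊤` if there is none). -/
def spaceTimeComplexity (G : Digraph V) : ℕ∞ :=
  ⨅ P : Pebbling G (sinks G), (P.spaceTime : ℕ∞)

end Game

/-! ### Argon2i graphs -/

/-- The node set `[N] = {1, …, N}`. -/
abbrev Node (N : ℕ) : Type := {v : ℕ // v ∈ Finset.Icc 1 N}

/-- The graph on `[N]` with the edges `(i, i + 1)` and `(r i, i)`. A value `r i` outside
`{1, …, i - 1}` contributes no edge (the pair would not be an edge of a directed acyclic graph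
on `[N]`). -/
def argonGraph {N : ℕ} (r : Node N → ℕ) : Digraph (Node N) where
  Adj u v := (v : ℕ) = u + 1 ∨ ((u : ℕ) = r v ∧ (u : ℕ) < v)

/-- Argon2i-A: `r i` is uniform on `{1, …, i - 2}`; for `i ≤ 2` this set is empty, and the value
`0` stands for "no edge". -/
def argonALaw (i : ℕ) : PMF ℕ :=
  if h : (Finset.Icc 1 (i - 2)).Nonempty then PMF.uniformOfFinset (Finset.Icc 1 (i - 2)) h
  else PMF.pure 0

/-- Argon2i-B: `r i = j` iff `i (1 - x² / N²) ∈ (j - 1, j]`, where `x` is uniform on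
`{1, …, N}`. -/
def argonBLaw {N : ℕ} (i : Node N) : PMF ℕ :=
  (PMF.uniformOfFinset (Finset.Icc 1 N) ⟨i, i.2⟩).map
    fun x => ⌈(i : ℝ) * (1 - (x : ℝ) ^ 2 / (N : ℝ) ^ 2)⌉₊

/-- The joint law of the independent choices `r i`, `i ∈ [N]`, for Argon2i-A. -/
def argonA (N : ℕ) : Measure (Node N → ℕ) :=
  Measure.pi fun i => (argonALaw i).toMeasure

/-- The joint law of the independent choices `r i`, `i ∈ [N]`, for Argon2i-B. -/
def argonB (N : ℕ) : Measure (Node N → ℕ) :=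
  Measure.pi fun i => (argonBLaw i).toMeasure

/-- The events `E N` hold with high probability: for every `c > 0`, with probability at least
`1 - N ^ (-c)` for all large `N`. -/
def WithHighProbability {Ω : ℕ → Type*} [∀ N, MeasurableSpace (Ω N)]
    (μ : ∀ N, Measure (Ω N)) (E : ∀ N, Set (Ω N)) : Prop :=
  ∀ c : ℝ, 0 < c → ∀ᶠ N : ℕ in atTop, 1 - (N : ℝ) ^ (-c) ≤ (μ N).real (E N)

end QuantumPebbling

end

/-!
If every path of `G - S` has at most `d` nodes, then with `S` pebbled so far, a block of `b`
consecutive nodes has at most `b * 2 ^ (d + 1)` ancestors reachable without passing through `S`.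
Recomputing them, pebbling the block and undoing everything except the pebbles on `S` takes
`2 * (d + b)` rounds; proceeding block by block pebbles `S`, and the reversed pebbling then removes
everything but the sink. With `b ≈ √N` and `d ≤ log N / 4` the time is `O(N)` and the space is
dominated by `|S|`.

In an Argon2i graph cut into `q` layers of consecutive nodes, `S` consists of the multiples of `m`
and of the nodes whose random parent lies in their own layer. Every random edge outside `S` climbs
to a higher layer, and a run of successor edges outside `S` has fewer than `m` of them, so that
`d ≤ q * m`. The number of nodes with a parent in their own layer is a sum of independent
indicators, concentrated around its mean: `O(N log q / q)` for Argon2i-A and `O(N / √q)` for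
Argon2i-B. Balancing it against `N / m` under `q * m ≈ log N / 4` gives `q = m ≈ √(log N)` for
Argon2i-A, and `q = m ^ 2` with `m ≈ (log N) ^ (1 / 3)` for Argon2i-B.
-/

namespace QuantumPebbling

section ConfigurationGraph

variable {V : Type*} {G : Digraph V} {s t : ℕ}

/-- `P` and `Q` may be consecutive configurations of a legal parallel quantum pebbling, in either
order: the rule `parents(P \ Q) ∪ parents(Q \ P) ⊆ P ∩ Q` of the paper. -/
def IsLegalMove (G : Digraph V) (P Q : Finset V) : Prop :=
  parents G (symmDiff (P : Set V) Q) ⊆ P ∩ Q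

theorem parents_mono {W W' : Set V} (h : W ⊆ W') : parents G W ⊆ parents G W' :=
  fun _ ⟨w, hw, hu⟩ => ⟨w, h hw, hu⟩

theorem IsLegalMove.symm {P Q : Finset V} (h : IsLegalMove G P Q) : IsLegalMove G Q P := by
  rwa [IsLegalMove, symmDiff_comm, Set.inter_comm]

theorem IsLegalMove.union_right [DecidableEq V] {P Q : Finset V} (h : IsLegalMove G P Q)
    (T : Finset V) : IsLegalMove G (P ∪ T) (Q ∪ T) := by
  have hsub : symmDiff ((P ∪ T : Finset V) : Set V) (Q ∪ T : Finset V) ⊆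
      symmDiff (P : Set V) Q := by
    intro x
    simp only [Finset.coe_union, Set.mem_symmDiff, Set.mem_union]
    tauto
  intro u hu
  have hPQ := h (parents_mono hsub hu)
  exact ⟨Finset.mem_union_left T hPQ.1, Finset.mem_union_left T hPQ.2⟩

/-- The configurations with at most `s` pebbles, adjacent when a legal move leads from one to the
other. Idle rounds are dropped, so `(configGraph G s).edist P Q` is the least number of rounds in
which `s` pebbles can get from `P` to `Q`. -/
def configGraph (G : Digraph V) (s : ℕ) : SimpleGraph (Finset V) where
  Adj P Q := P ≠ Q ∧ IsLegalMove G P Q ∧ P.card ≤ s ∧ Q.card ≤ s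
  symm := ⟨fun _ _ ⟨hne, hlegal, hP, hQ⟩ => ⟨hne.symm, hlegal.symm, hQ, hP⟩⟩
  loopless := ⟨fun _ h => h.1 rfl⟩

theorem configGraph_mono (h : s ≤ t) : configGraph G s ≤ configGraph G t :=
  fun _ _ ⟨hne, hlegal, hP, hQ⟩ => ⟨hne, hlegal, hP.trans h, hQ.trans h⟩

theorem IsLegalMove.edist_le_one {P Q : Finset V} (h : IsLegalMove G P Q) (hP : P.card ≤ s)
    (hQ : Q.card ≤ s) : (configGraph G s).edist P Q ≤ 1 := by
  rw [SimpleGraph.edist_le_one_iff_adj_or_eq]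
  by_cases hPQ : P = Q
  · exact .inr hPQ
  · exact .inl ⟨hPQ, h, hP, hQ⟩

theorem edist_map_le {α β : Type*} {H : SimpleGraph α} {K : SimpleGraph β} {f : α → β}
    (hf : ∀ a b, H.Adj a b → K.edist (f a) (f b) ≤ 1) (a b : α) :
    K.edist (f a) (f b) ≤ H.edist a b := by
  by_cases hab : H.edist a b = ⊤
  · simp only [hab, le_top]
  obtain ⟨p, hp⟩ := SimpleGraph.exists_walk_of_edist_ne_top hab
  rw [← hp]
  clear hp hab
  induction p with
  | nil => simp only [SimpleGraph.edist_self, zero_le]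
  | @cons a b c h p ih =>
    calc K.edist (f a) (f c) ≤ K.edist (f a) (f b) + K.edist (f b) (f c) :=
          SimpleGraph.edist_triangle
      _ ≤ 1 + p.length := add_le_add (hf a b h) ih
      _ = (SimpleGraph.Walk.cons h p).length := by
          rw [SimpleGraph.Walk.length_cons, Nat.cast_add_one, add_comm]

theorem edist_le_of_forall_succ {α : Type*} {H : SimpleGraph α} (f : ℕ → α)
    (hf : ∀ i, H.edist (f i) (f (i + 1)) ≤ 1) (n : ℕ) : H.edist (f 0) (f n) ≤ n := by
  induction n with
  | zero => simp only [SimpleGraph.edist_self, zero_le]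
  | succ n ih =>
    push_cast
    exact SimpleGraph.edist_triangle.trans (add_le_add ih (hf n))

theorem edist_union_right_le [DecidableEq V] (P Q T : Finset V) :
    (configGraph G (s + T.card)).edist (P ∪ T) (Q ∪ T) ≤ (configGraph G s).edist P Q := by
  refine edist_map_le (H := configGraph G s) (f := (· ∪ T)) (fun P Q ⟨_, hlegal, hP, hQ⟩ => ?_) P Q
  have card_le {R : Finset V} (hR : R.card ≤ s) : (R ∪ T).card ≤ s + T.card :=
    (Finset.card_union_le R T).trans (Nat.add_le_add_right hR _)
  exact (hlegal.union_right T).edist_le_one (card_le hP) (card_le hQ)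

theorem edist_union_le_of_rank [DecidableEq V] {B A : Finset V} {d : ℕ} (φ : V → ℕ)
    (hd : ∀ v ∈ A, φ v < d)
    (hA : ∀ v ∈ A, ∀ u, G.Adj u v → u ∈ B ∨ u ∈ A ∧ φ u < φ v) (hs : (B ∪ A).card ≤ s) :
    (configGraph G s).edist B (B ∪ A) ≤ d := by
  set level : ℕ → Finset V := fun i => B ∪ A.filter (φ · < i)
  have hcard (i : ℕ) : (level i).card ≤ s :=
    (Finset.card_le_card (Finset.union_subset_union_right (Finset.filter_subset _ _))).trans hs
  have hlegal (i : ℕ) : IsLegalMove G (level i) (level (i + 1)) := by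
    rintro u ⟨v, hv, huv⟩
    simp only [level, Set.mem_symmDiff, Finset.mem_coe, Finset.mem_union, Finset.mem_filter] at hv
    simp only [level, Set.mem_inter_iff, Finset.mem_coe, Finset.mem_union, Finset.mem_filter]
    have hvA : v ∈ A ∧ φ v < i + 1 := by grind
    rcases hA v hvA.1 u huv with hu | ⟨hu, hlt⟩
    · exact ⟨.inl hu, .inl hu⟩
    · exact ⟨.inr ⟨hu, by omega⟩, .inr ⟨hu, by omega⟩⟩
  have hzero : level 0 = B := by simp [level]
  have hlast : level d = B ∪ A := by simp only [level, Finset.filter_true_of_mem hd]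
  simpa only [hzero, hlast] using
    edist_le_of_forall_succ level (fun i => (hlegal i).edist_le_one (hcard i) (hcard _)) d

theorem spaceTimeComplexity_le_of_edist_le {T : Finset V} (hT : (T : Set V) = sinks G)
    (h : (configGraph G s).edist ∅ T ≤ t) : spaceTimeComplexity G ≤ (t * s : ℕ) := by
  obtain ⟨p, hp⟩ := SimpleGraph.exists_walk_of_edist_ne_top (h.trans_lt (ENat.natCast_lt_top t)).ne
  have hlegal {i : ℕ} (hi : i < p.length) :
      parents G (symmDiff (p.getVert i : Set V) (p.getVert (i + 1))) ⊆
        p.getVert i ∩ p.getVert (i + 1) := (p.adj_getVert_succ hi).2.1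
  let P : Pebbling G (sinks G) :=
    { time := p.length
      conf := p.getVert
      start := p.getVert_zero
      finish := by rw [p.getVert_length, hT]
      add_legal i hi x hx u hu :=
        (hlegal hi (parents_mono (Set.singleton_subset_iff.2 (.inr hx)) hu)).1
      delete_legal i hi x hx u hu :=
        (hlegal hi (parents_mono (Set.singleton_subset_iff.2 (.inl hx)) hu)).1
      reversible i hi := Set.union_subset
        (fun _ hu => (hlegal hi (parents_mono Set.subset_union_right hu)).2)
        (fun _ hu => (hlegal hi (parents_mono Set.subset_union_left hu)).2) }
  have hspace : P.space ≤ s := by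
    refine Finset.sup_le fun i hi => ?_
    obtain ⟨hi₁, hi₂⟩ := Finset.mem_Icc.1 hi
    obtain ⟨j, rfl⟩ := Nat.exists_eq_add_of_le' hi₁
    exact (p.adj_getVert_succ hi₂).2.2.2
  have htime : P.time ≤ t := by exact_mod_cast hp.trans_le h
  exact (iInf_le _ P).trans (by exact_mod_cast Nat.mul_le_mul htime hspace)

end ConfigurationGraph

section DepthReducing

variable {V : Type*} {G : Digraph V} {S : Finset V} {d δ : ℕ}

/-- `S` is a depth-reducing set: no path of `G - S` has more than `d` nodes. The bound is encoded
by a rank function that increases along the edges of `G - S`. -/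
def IsDepthReducing (G : Digraph V) (S : Finset V) (d : ℕ) : Prop :=
  ∃ φ : V → ℕ, (∀ v ∉ S, φ v < d) ∧ ∀ u v, G.Adj u v → u ∉ S → v ∉ S → φ u < φ v

theorem IsDepthReducing.mono {S' : Finset V} (hS : IsDepthReducing G S d) (h : S ⊆ S') :
    IsDepthReducing G S' d := by
  obtain ⟨φ, hφd, hφ⟩ := hS
  exact ⟨φ, fun v hv => hφd v (mt (@h v) hv),
    fun u v huv hu hv => hφ u v huv (mt (@h u) hu) (mt (@h v) hv)⟩

variable [Fintype V]

open Classical in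
/-- The parents of `W` outside `S`. -/
noncomputable def parentsOutside (G : Digraph V) (S W : Finset V) : Finset V :=
  {u | u ∉ S ∧ u ∈ parents G W}

open Classical in
/-- The nodes from which a nonempty path that avoids `S` before its end leads to `W`: when `S` is
pebbled, these are the nodes still needed to pebble `W`. -/
noncomputable def ancestorsOutside (G : Digraph V) (S W : Finset V) : Finset V :=
  {u | ∃ w ∈ W, Relation.TransGen (fun x y => x ∉ S ∧ G.Adj x y) u w}

theorem mem_parentsOutside {W : Finset V} {u : V} :
    u ∈ parentsOutside G S W ↔ u ∉ S ∧ ∃ w ∈ W, G.Adj u w := by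
  classical exact Finset.mem_filter_univ u

theorem mem_ancestorsOutside {W : Finset V} {u : V} :
    u ∈ ancestorsOutside G S W ↔
      ∃ w ∈ W, Relation.TransGen (fun x y => x ∉ S ∧ G.Adj x y) u w := by
  simp only [ancestorsOutside, Finset.mem_filter_univ]

theorem notMem_of_mem_ancestorsOutside {W : Finset V} {u : V}
    (hu : u ∈ ancestorsOutside G S W) : u ∉ S := by
  obtain ⟨w, -, huw⟩ := mem_ancestorsOutside.1 hu
  obtain ⟨x, hux, -⟩ := Relation.TransGen.head'_iff.1 huw
  exact hux.1

theorem card_parentsOutside_le (hδ : ∀ v, (parents G {v}).ncard ≤ δ) (W : Finset V) :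
    (parentsOutside G S W).card ≤ W.card * δ := by
  have hsub : (parentsOutside G S W : Set V) ⊆ ⋃ w ∈ W, parents G {w} := by
    intro u hu
    simpa [parents] using (mem_parentsOutside.1 hu).2
  calc (parentsOutside G S W).card = (parentsOutside G S W : Set V).ncard :=
        (Set.ncard_coe_finset _).symm
    _ ≤ (⋃ w ∈ W, parents G {w}).ncard := Set.ncard_le_ncard hsub
    _ ≤ ∑ w ∈ W, (parents G {w}).ncard := W.set_ncard_biUnion_le _
    _ ≤ W.card * δ := Finset.sum_le_card_nsmul _ _ _ fun w _ => hδ w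

variable [DecidableEq V]

theorem mem_ancestorsOutside_of_adj {W : Finset V} {u v : V} (hu : u ∉ S) (huv : G.Adj u v)
    (hv : v ∈ W ∪ ancestorsOutside G S W) : u ∈ ancestorsOutside G S W := by
  rw [mem_ancestorsOutside]
  rcases Finset.mem_union.1 hv with hv | hv
  · exact ⟨v, hv, .single ⟨hu, huv⟩⟩
  · obtain ⟨w, hw, hvw⟩ := mem_ancestorsOutside.1 hv
    exact ⟨w, hw, .head ⟨hu, huv⟩ hvw⟩

theorem ancestorsOutside_subset (G : Digraph V) (S W : Finset V) :
    ancestorsOutside G S W ⊆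
      parentsOutside G S W ∪ ancestorsOutside G S (parentsOutside G S W) := by
  intro u hu
  obtain ⟨w, hw, huw⟩ := mem_ancestorsOutside.1 hu
  obtain ⟨x, hux, hxS, hxw⟩ := Relation.TransGen.tail'_iff.1 huw
  have hx : x ∈ parentsOutside G S W := mem_parentsOutside.2 ⟨hxS, w, hw, hxw⟩
  rcases Relation.reflTransGen_iff_eq_or_transGen.1 hux with rfl | hux
  · exact Finset.mem_union_left _ hx
  · exact Finset.mem_union_right _ (mem_ancestorsOutside.2 ⟨x, hx, hux⟩)

theorem card_union_ancestorsOutside_le_of_rank (hδ : ∀ v, (parents G {v}).ncard ≤ δ) {φ : V → ℕ}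
    (hφ : ∀ u v, G.Adj u v → u ∉ S → v ∉ S → φ u < φ v) (j : ℕ) (W : Finset V)
    (hW : ∀ u ∈ parentsOutside G S W, φ u < j) :
    (W ∪ ancestorsOutside G S W).card ≤ W.card * ∑ i ∈ Finset.range (j + 1), δ ^ i := by
  induction j generalizing W with
  | zero =>
    have hparents : parentsOutside G S W = ∅ :=
      Finset.eq_empty_of_forall_notMem fun u hu => absurd (hW u hu) (Nat.not_lt_zero _)
    have hancestors : ancestorsOutside G S W = ∅ := by
      refine Finset.subset_empty.1 ((ancestorsOutside_subset G S W).trans fun u hu => ?_)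
      simp [hparents, mem_ancestorsOutside] at hu
    simp [hancestors]
  | succ j ih =>
    set W' := parentsOutside G S W
    have hrank : ∀ u ∈ parentsOutside G S W', φ u < j := by
      intro u hu
      obtain ⟨huS, v, hv, huv⟩ := mem_parentsOutside.1 hu
      exact (hφ u v huv huS (mem_parentsOutside.1 hv).1).trans_le (Nat.lt_succ_iff.1 (hW v hv))
    calc (W ∪ ancestorsOutside G S W).card
        ≤ (W ∪ (W' ∪ ancestorsOutside G S W')).card := Finset.card_le_card
          (Finset.union_subset_union_right (ancestorsOutside_subset G S W))
      _ ≤ W.card + W'.card * ∑ i ∈ Finset.range (j + 1), δ ^ i :=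
          (Finset.card_union_le _ _).trans (Nat.add_le_add_left (ih W' hrank) _)
      _ ≤ W.card + W.card * δ * ∑ i ∈ Finset.range (j + 1), δ ^ i := by
          gcongr
          exact card_parentsOutside_le hδ W
      _ = W.card * ∑ i ∈ Finset.range (j + 1 + 1), δ ^ i := by
          rw [geom_sum_succ (n := j + 1)]
          ring

theorem card_union_ancestorsOutside_le (hδ : ∀ v, (parents G {v}).ncard ≤ δ)
    (hS : IsDepthReducing G S d) (W : Finset V) :
    (W ∪ ancestorsOutside G S W).card ≤ W.card * ∑ i ∈ Finset.range (d + 1), δ ^ i := by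
  obtain ⟨φ, hφd, hφ⟩ := hS
  exact card_union_ancestorsOutside_le_of_rank hδ hφ d W
    fun u hu => hφd u (mem_parentsOutside.1 hu).1

/-- The nodes that are pebbled while the block `a ≤ pos v < a + b` is processed: the block and the
nodes outside `S` needed to pebble it. -/
noncomputable def workspace (G : Digraph V) (S : Finset V) (pos : V → ℕ) (a b : ℕ) : Finset V :=
  let block : Finset V := {v | a ≤ pos v ∧ pos v < a + b}
  block ∪ ancestorsOutside G S block

theorem card_workspace_le {pos : V → ℕ} (hpos : Function.Injective pos)
    (hδ : ∀ v, (parents G {v}).ncard ≤ δ) (hS : IsDepthReducing G S d) (a b : ℕ) :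
    (workspace G S pos a b).card ≤ b * ∑ i ∈ Finset.range (d + 1), δ ^ i := by
  have hblock : (Finset.univ.filter fun v => a ≤ pos v ∧ pos v < a + b).card ≤ b := by
    simpa using Finset.card_le_card_of_injOn (t := Finset.Ico a (a + b)) pos
      (fun v hv => by simpa using hv) hpos.injOn
  exact (card_union_ancestorsOutside_le hδ hS _).trans (Nat.mul_le_mul_right _ hblock)

theorem mem_workspace {pos : V → ℕ} {a b : ℕ} {v : V} (ha : a ≤ pos v) (hb : pos v < a + b) :
    v ∈ workspace G S pos a b :=
  Finset.mem_union_left _ ((Finset.mem_filter_univ v).2 ⟨ha, hb⟩)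

theorem notMem_of_mem_workspace_of_lt {pos : V → ℕ} {a b : ℕ} {v : V}
    (hv : v ∈ workspace G S pos a b) (ha : pos v < a) : v ∉ S := by
  rcases Finset.mem_union.1 hv with hv | hv
  · exact absurd ((Finset.mem_filter_univ v).1 hv).1 ha.not_ge
  · exact notMem_of_mem_ancestorsOutside hv

theorem mem_workspace_of_adj {pos : V → ℕ} {a b : ℕ} {u v : V} (hu : u ∉ S) (huv : G.Adj u v)
    (hv : v ∈ workspace G S pos a b) : u ∈ workspace G S pos a b :=
  Finset.mem_union_right _ (mem_ancestorsOutside_of_adj hu huv hv)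

theorem lt_of_mem_workspace {pos : V → ℕ} (hadj : ∀ u v, G.Adj u v → pos u < pos v) {a b : ℕ}
    {v : V} (hv : v ∈ workspace G S pos a b) : pos v < a + b := by
  rcases Finset.mem_union.1 hv with hv | hv
  · exact ((Finset.mem_filter_univ v).1 hv).2
  · obtain ⟨w, hw, hvw⟩ := mem_ancestorsOutside.1 hv
    have hlt : Relation.TransGen (· < ·) (pos v) (pos w) := hvw.lift pos fun u v h => hadj u v h.2
    rw [Relation.transGen_eq_self] at hlt
    exact hlt.trans ((Finset.mem_filter_univ w).1 hw).2

theorem edist_union_workspace_le {pos : V → ℕ} (hadj : ∀ u v, G.Adj u v → pos u < pos v)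
    (hS : IsDepthReducing G S d) {a b s : ℕ} {C : Finset V} (hC : S.filter (pos · < a) ⊆ C)
    (hs : (C ∪ workspace G S pos a b).card ≤ s) :
    (configGraph G s).edist C (C ∪ workspace G S pos a b) ≤ (d + b : ℕ) := by
  obtain ⟨φ, hφd, hφ⟩ := hS
  -- First the ancestors are pebbled in the order of `φ`, then the block in the order of `pos`.
  refine edist_union_le_of_rank (fun v => if pos v < a then φ v else d + (pos v - a))
    (fun v hv => ?_) (fun v hv u huv => ?_) hs
  · have hvb := lt_of_mem_workspace hadj hv
    split_ifs with hva
    · exact (hφd v (notMem_of_mem_workspace_of_lt hv hva)).trans_le (Nat.le_add_right _ _)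
    · omega
  have hlt := hadj u v huv
  have hvb := lt_of_mem_workspace hadj hv
  by_cases hua : pos u < a
  · by_cases hu : u ∈ S
    · exact .inl (hC (Finset.mem_filter.2 ⟨hu, hua⟩))
    · refine .inr ⟨mem_workspace_of_adj hu huv hv, ?_⟩
      rw [if_pos hua]
      split_ifs with hva
      · exact hφ u v huv hu (notMem_of_mem_workspace_of_lt hv hva)
      · exact (hφd u hu).trans_le (Nat.le_add_right _ _)
  · refine .inr ⟨mem_workspace (not_lt.1 hua) (by omega), ?_⟩
    rw [if_neg hua, if_neg (by omega)]
    omega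

end DepthReducing

section BlockByBlock

variable {V : Type*} [Finite V] {G : Digraph V} {S : Finset V} {pos : V → ℕ} {d δ : ℕ}

theorem edist_filter_lt_add_le (hpos : Function.Injective pos)
    (hadj : ∀ u v, G.Adj u v → pos u < pos v) (hδ : ∀ v, (parents G {v}).ncard ≤ δ)
    (hS : IsDepthReducing G S d) (a b : ℕ) :
    (configGraph G (S.card + b * ∑ i ∈ Finset.range (d + 1), δ ^ i)).edist
      (S.filter (pos · < a)) (S.filter (pos · < a + b)) ≤ (2 * (d + b) : ℕ) := by
  classical
  have := Fintype.ofFinite V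
  set W := workspace G S pos a b
  set s := S.card + b * ∑ i ∈ Finset.range (d + 1), δ ^ i
  have hcard {C : Finset V} (hC : C ⊆ S) : (C ∪ W).card ≤ s :=
    (Finset.card_union_le _ _).trans
      (Nat.add_le_add (Finset.card_le_card hC) (card_workspace_le hpos hδ hS a b))
  have hfilter : S.filter (pos · < a) ⊆ S.filter (pos · < a + b) :=
    Finset.monotone_filter_right S fun v _ hv => hv.trans_le (Nat.le_add_right a b)
  have hunion : S.filter (pos · < a) ∪ W = S.filter (pos · < a + b) ∪ W := by
    refine (Finset.union_subset_union_left hfilter).antisymm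
      (Finset.union_subset (fun v hv => ?_) Finset.subset_union_right)
    obtain ⟨hvS, hvb⟩ := Finset.mem_filter.1 hv
    by_cases hva : pos v < a
    · exact Finset.mem_union_left _ (Finset.mem_filter.2 ⟨hvS, hva⟩)
    · exact Finset.mem_union_right _ (mem_workspace (not_lt.1 hva) hvb)
  have hforward := edist_union_workspace_le hadj hS subset_rfl
    (hcard (S.filter_subset (pos · < a)))
  have hbackward := edist_union_workspace_le hadj hS hfilter
    (hcard (S.filter_subset (pos · < a + b)))
  rw [SimpleGraph.edist_comm, ← hunion] at hbackward
  calc _ ≤ ((d + b : ℕ) : ℕ∞) + (d + b : ℕ) :=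
        SimpleGraph.edist_triangle.trans (add_le_add hforward hbackward)
    _ = (2 * (d + b) : ℕ) := by push_cast; ring

theorem edist_empty_filter_lt_mul_le (hpos : Function.Injective pos)
    (hadj : ∀ u v, G.Adj u v → pos u < pos v) (hδ : ∀ v, (parents G {v}).ncard ≤ δ)
    (hS : IsDepthReducing G S d) (b k : ℕ) :
    (configGraph G (S.card + b * ∑ i ∈ Finset.range (d + 1), δ ^ i)).edist
      ∅ (S.filter (pos · < k * b)) ≤ (k * (2 * (d + b)) : ℕ) := by
  induction k with
  | zero => simp
  | succ k ih =>
    rw [add_mul k, add_mul k, one_mul, one_mul, Nat.cast_add]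
    exact SimpleGraph.edist_triangle.trans
      (add_le_add ih (edist_filter_lt_add_le hpos hadj hδ hS (k * b) b))

theorem spaceTimeComplexity_le_of_isDepthReducing (hpos : Function.Injective pos)
    (hadj : ∀ u v, G.Adj u v → pos u < pos v) (hδ : ∀ v, (parents G {v}).ncard ≤ δ)
    (hS : IsDepthReducing G S d) {b k : ℕ} (hk : ∀ v, pos v < k * b) {T : Finset V}
    (hT : (T : Set V) = sinks G) (hTS : T ⊆ S) :
    spaceTimeComplexity G ≤ (4 * k * (d + b) *
      (S.card + b * ∑ i ∈ Finset.range (d + 1), δ ^ i + T.card) : ℕ) := by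
  classical
  set s := S.card + b * ∑ i ∈ Finset.range (d + 1), δ ^ i
  have hforward : (configGraph G s).edist ∅ S ≤ (k * (2 * (d + b)) : ℕ) := by
    simpa only [Finset.filter_true_of_mem fun v _ => hk v] using
      edist_empty_filter_lt_mul_le hpos hadj hδ hS b k
  -- The forward pebbling is reversed with the pebbles on `T` kept in place.
  have hbackward : (configGraph G (s + T.card)).edist S T ≤ (k * (2 * (d + b)) : ℕ) := by
    have h := (edist_union_right_le S ∅ T).trans (SimpleGraph.edist_comm.trans_le hforward)
    rwa [Finset.union_eq_left.2 hTS, Finset.empty_union] at h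
  refine spaceTimeComplexity_le_of_edist_le hT ?_
  calc (configGraph G (s + T.card)).edist ∅ T
      ≤ (configGraph G (s + T.card)).edist ∅ S + (configGraph G (s + T.card)).edist S T :=
        SimpleGraph.edist_triangle
    _ ≤ (k * (2 * (d + b)) : ℕ) + (k * (2 * (d + b)) : ℕ) :=
        add_le_add ((SimpleGraph.edist_anti (configGraph_mono (Nat.le_add_right s _))).trans
          hforward) hbackward
    _ = (4 * k * (d + b) : ℕ) := by push_cast; ring

end BlockByBlock

section Argon

variable {N : ℕ} (r : Node N → ℕ)

theorem argonGraph_adj_lt {r : Node N → ℕ} {u v : Node N} (h : (argonGraph r).Adj u v) :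
    (u : ℕ) < v := by
  rcases h with h | h
  · exact h ▸ Nat.lt_succ_self _
  · exact h.2

theorem ncard_parents_argonGraph_le (v : Node N) : (parents (argonGraph r) {v}).ncard ≤ 2 := by
  have hsub : Subtype.val '' parents (argonGraph r) {v} ⊆ {(v : ℕ) - 1, r v} := by
    rintro _ ⟨u, ⟨w, rfl, h | h⟩, rfl⟩
    · exact .inl (by omega)
    · exact .inr h.1
  rw [← Set.ncard_image_of_injective _ Subtype.val_injective]
  exact (Set.ncard_le_ncard hsub).trans
    ((Set.ncard_insert_le _ _).trans_eq (by rw [Set.ncard_singleton]))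

theorem sinks_argonGraph (hN : 0 < N) :
    sinks (argonGraph r) = {⟨N, Finset.mem_Icc.2 ⟨hN, le_rfl⟩⟩} := by
  ext ⟨v, hv⟩
  simp only [sinks, Set.mem_ofPred_eq, Set.mem_singleton_iff, Subtype.mk.injEq]
  constructor
  · intro h
    by_contra hne
    have hvN := (Finset.mem_Icc.1 hv).2
    exact h ⟨⟨v + 1, Finset.mem_Icc.2 ⟨by omega, by omega⟩⟩, .inl rfl⟩
  · rintro rfl ⟨⟨u, hu⟩, huv⟩
    exact absurd (argonGraph_adj_lt huv) (Finset.mem_Icc.1 hu).2.not_gt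

/-- The nodes `v` for which `r v` lies in the same layer as `v`, where the layers are the
intervals `[k * ℓ, (k + 1) * ℓ)`. -/
def sameLayer (ℓ : ℕ) : Finset (Node N) := {v | r v / ℓ = v / ℓ}

theorem card_filter_dvd_le (m : ℕ) :
    (Finset.univ.filter fun v : Node N => m ∣ (v : ℕ)).card ≤ N / m := by
  rw [← Nat.Ioc_filter_dvd_card_eq_div]
  refine Finset.card_le_card_of_injOn Subtype.val (fun v hv => ?_) Subtype.val_injective.injOn
  have hvN := Finset.mem_Icc.1 v.2
  exact Finset.mem_filter.2 ⟨Finset.mem_Ioc.2 hvN, (Finset.mem_filter.1 hv).2⟩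

theorem mod_add_one_of_not_dvd {a m : ℕ} (h : ¬ m ∣ a + 1) : (a + 1) % m = a % m + 1 := by
  have hdiv := Nat.succ_div_of_not_dvd h
  have h₁ := Nat.div_add_mod (a + 1) m
  have h₂ := Nat.div_add_mod a m
  rw [hdiv] at h₁
  omega

theorem isDepthReducing_sameLayer_union_dvd {ℓ m q : ℕ} (hm : 0 < m) (hq : N < q * ℓ) :
    IsDepthReducing (argonGraph r)
      (sameLayer r ℓ ∪ Finset.univ.filter fun v : Node N => m ∣ (v : ℕ)) (q * m) := by
  have hℓ : 0 < ℓ := Nat.pos_of_mul_pos_left (Nat.zero_lt_of_lt hq)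
  refine ⟨fun v => v / ℓ * m + v % m, fun v _ => ?_, fun u v huv _ hv => ?_⟩
  · have hlayer : (v : ℕ) / ℓ < q :=
      (Nat.div_lt_iff_lt_mul hℓ).2 ((Finset.mem_Icc.1 v.2).2.trans_lt hq)
    calc (v : ℕ) / ℓ * m + v % m < v / ℓ * m + m := Nat.add_lt_add_left (Nat.mod_lt _ hm) _
      _ = (v / ℓ + 1) * m := (Nat.succ_mul _ _).symm
      _ ≤ q * m := Nat.mul_le_mul_right m hlayer
  have hle : (u : ℕ) / ℓ ≤ v / ℓ := Nat.div_le_div_right (argonGraph_adj_lt huv).le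
  simp only [sameLayer, Finset.mem_union, Finset.mem_filter_univ, not_or] at hv
  rcases huv with hsucc | ⟨hrandom, -⟩
  · have hmod : (v : ℕ) % m = u % m + 1 := by
      rw [hsucc] at hv ⊢
      exact mod_add_one_of_not_dvd hv.2
    calc (u : ℕ) / ℓ * m + u % m < v / ℓ * m + (u % m + 1) :=
          Nat.add_lt_add_of_le_of_lt (Nat.mul_le_mul_right m hle) (Nat.lt_succ_self _)
      _ = v / ℓ * m + v % m := by rw [hmod]
  · have hlt : (u : ℕ) / ℓ < v / ℓ := hle.lt_of_ne (hrandom ▸ hv.1)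
    calc (u : ℕ) / ℓ * m + u % m < u / ℓ * m + m := Nat.add_lt_add_left (Nat.mod_lt _ hm) _
      _ = (u / ℓ + 1) * m := (Nat.succ_mul _ _).symm
      _ ≤ v / ℓ * m := Nat.mul_le_mul_right m hlt
      _ ≤ v / ℓ * m + v % m := Nat.le_add_right _ _

theorem spaceTimeComplexity_argonGraph_le (hN : 0 < N) {ℓ m q b k : ℕ} (hm : 0 < m)
    (hq : N < q * ℓ) (hk : N < k * b) :
    spaceTimeComplexity (argonGraph r) ≤ (4 * k * (q * m + b) *
      ((sameLayer r ℓ).card + N / m + 1 + b * 2 ^ (q * m + 1) + 1) : ℕ) := by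
  set n : Node N := ⟨N, Finset.mem_Icc.2 ⟨hN, le_rfl⟩⟩
  set M := Finset.univ.filter fun v : Node N => m ∣ (v : ℕ)
  have hS : IsDepthReducing (argonGraph r) (sameLayer r ℓ ∪ M ∪ {n}) (q * m) :=
    (isDepthReducing_sameLayer_union_dvd r hm hq).mono Finset.subset_union_left
  have hcard : (sameLayer r ℓ ∪ M ∪ {n}).card ≤ (sameLayer r ℓ).card + N / m + 1 :=
    calc (sameLayer r ℓ ∪ M ∪ {n}).card ≤ (sameLayer r ℓ).card + M.card + 1 :=
          (Finset.card_union_le _ _).trans (Nat.add_le_add_right (Finset.card_union_le _ _) 1)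
      _ ≤ (sameLayer r ℓ).card + N / m + 1 := by gcongr; exact card_filter_dvd_le m
  have hgeom : ∑ i ∈ Finset.range (q * m + 1), 2 ^ i ≤ 2 ^ (q * m + 1) :=
    (Nat.geomSum_lt le_rfl fun _ => Finset.mem_range.1).le
  refine (spaceTimeComplexity_le_of_isDepthReducing Subtype.val_injective
    (fun _ _ => argonGraph_adj_lt) (ncard_parents_argonGraph_le r) hS
    (fun v => (Finset.mem_Icc.1 v.2).2.trans_lt hk) (T := {n})
    (by rw [Finset.coe_singleton, sinks_argonGraph r hN]) Finset.subset_union_right).trans ?_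
  rw [Finset.card_singleton, Nat.cast_le]
  gcongr

theorem four_mul_succ_mul_add_succ_le {d s : ℕ} (hds : 4 ^ d ≤ s) :
    4 * (s + 1) * (d + (s + 1)) ≤ 24 * (s * s) := by
  have hd : d ≤ s := (Nat.lt_pow_self (by norm_num)).le.trans hds
  have hs : 1 ≤ s := (Nat.one_le_pow' d 3).trans hds
  nlinarith

theorem succ_mul_two_pow_mul_le {d s : ℕ} (hds : 4 ^ d ≤ s) :
    (s + 1) * 2 ^ (d + 1) * d ≤ 4 * (s * s) := by
  have hs : 1 ≤ s := (Nat.one_le_pow' d 3).trans hds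
  calc (s + 1) * 2 ^ (d + 1) * d ≤ (2 * s) * 2 ^ (d + 1) * 2 ^ d := by
        gcongr
        exacts [by omega, Nat.lt_two_pow_self.le]
    _ = 4 * (s * 4 ^ d) := by rw [show 4 = 2 * 2 from rfl, mul_pow]; ring
    _ ≤ 4 * (s * s) := by gcongr

theorem natCast_add_div_add_le (c : ℕ) {m e : ℕ} (hm : 0 < m) (hmN : m ≤ N) (he : e * m ≤ 4 * N) :
    ((c + N / m + 1 + e + 1 : ℕ) : ℝ) ≤ c + 7 * (N / m) := by
  have hm₀ : (0 : ℝ) < m := Nat.cast_pos.2 hm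
  have hdiv : ((N / m : ℕ) : ℝ) ≤ N / m := Nat.cast_div_le
  have hone : (1 : ℝ) ≤ N / m := (one_le_div₀ hm₀).2 (Nat.cast_le.2 hmN)
  have he' : (e : ℝ) ≤ 4 * (N / m) := by
    rw [← mul_div_assoc, le_div_iff₀ hm₀]
    exact_mod_cast he
  push_cast
  linarith

theorem spaceTimeComplexity_argonGraph_le_card_sameLayer {ℓ m q : ℕ} (hm : 0 < m)
    (hq : N < q * ℓ) (hqm : 16 ^ (q * m) ≤ N) :
    (spaceTimeComplexity (argonGraph r) : ℝ≥0∞) ≤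
      ENNReal.ofReal (24 * N * ((sameLayer r ℓ).card + 7 * (N / m))) := by
  have hN : 0 < N := (Nat.pow_pos (by norm_num)).trans_le hqm
  set d := q * m
  set s := N.sqrt
  have hds : 4 ^ d ≤ s := by rwa [Nat.le_sqrt, ← mul_pow]
  have hss : s * s ≤ N := N.sqrt_le
  have hmd : m ≤ d := Nat.le_mul_of_pos_left m (Nat.pos_of_mul_pos_right (Nat.zero_lt_of_lt hq))
  have hmN : m ≤ N := (hmd.trans (Nat.lt_pow_self (by norm_num)).le).trans hqm
  have htime : 4 * (s + 1) * (d + (s + 1)) ≤ 24 * N :=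
    (four_mul_succ_mul_add_succ_le hds).trans (Nat.mul_le_mul_left 24 hss)
  have hancestors : (s + 1) * 2 ^ (d + 1) * m ≤ 4 * N :=
    (Nat.mul_le_mul_left _ hmd).trans
      ((succ_mul_two_pow_mul_le hds).trans (Nat.mul_le_mul_left 4 hss))
  have hspace := natCast_add_div_add_le (sameLayer r ℓ).card hm hmN hancestors
  calc (spaceTimeComplexity (argonGraph r) : ℝ≥0∞)
      ≤ ((4 * (s + 1) * (d + (s + 1)) *
          ((sameLayer r ℓ).card + N / m + 1 + (s + 1) * 2 ^ (d + 1) + 1) : ℕ) : ℝ≥0∞) := by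
        exact_mod_cast ENat.toENNReal_le.2
          (spaceTimeComplexity_argonGraph_le r hN hm hq N.lt_succ_sqrt)
    _ ≤ ENNReal.ofReal (24 * N * ((sameLayer r ℓ).card + 7 * (N / m))) := by
        rw [← ENNReal.ofReal_natCast, Nat.cast_mul]
        gcongr
        exact_mod_cast htime

end Argon

section Chernoff

open ProbabilityTheory

variable {Ω ι : Type*} {mΩ : MeasurableSpace Ω} {μ : Measure Ω}

theorem mgf_indicator_one_le [IsProbabilityMeasure μ] {A : Set Ω} (hA : MeasurableSet A) (t : ℝ) :
    mgf (A.indicator fun _ => 1) μ t ≤ Real.exp (μ.real A * (Real.exp t - 1)) := by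
  have hexp (ω : Ω) : Real.exp (t * A.indicator (fun _ => 1) ω) =
      1 + A.indicator (fun _ => Real.exp t - 1) ω := by
    by_cases hω : ω ∈ A <;> simp [hω]
  calc mgf (A.indicator fun _ => 1) μ t = 1 + μ.real A * (Real.exp t - 1) := by
        simp_rw [mgf, hexp]
        rw [integral_add (integrable_const _) ((integrable_const _).indicator hA),
          integral_indicator_const _ hA, integral_const, probReal_univ, one_smul, smul_eq_mul]
    _ ≤ Real.exp (μ.real A * (Real.exp t - 1)) := by
        rw [add_comm]
        exact Real.add_one_le_exp _

theorem measureReal_le_sum_indicator_le_exp_neg [Fintype ι] {A : ι → Set Ω}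
    (hA : ∀ i, MeasurableSet (A i)) (hindep : iIndepSet A μ) {M : ℝ}
    (hM : ∑ i, μ.real (A i) ≤ M) :
    μ.real {ω | 3 * M ≤ ∑ i, (A i).indicator (fun _ => 1) ω} ≤ Real.exp (-M) := by
  have := hindep.isProbabilityMeasure
  have hmeas (i : ι) : Measurable ((A i).indicator fun _ => (1 : ℝ)) :=
    measurable_const.indicator (hA i)
  have hM₀ : 0 ≤ M := (Finset.sum_nonneg fun _ _ => measureReal_nonneg).trans hM
  have hexp (i : ι) : Integrable
      (fun ω => Real.exp (1 * (A i).indicator (fun _ => (1 : ℝ)) ω)) μ :=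
    integrable_exp_mul_of_le 1 1 zero_le_one (hmeas i).aemeasurable
      (.of_forall (Set.indicator_le_self' fun _ _ => zero_le_one))
  calc μ.real {ω | 3 * M ≤ ∑ i, (A i).indicator (fun _ => 1) ω}
      ≤ Real.exp (-1 * (3 * M)) * mgf (∑ i, (A i).indicator fun _ => 1) μ 1 := by
        simpa only [Finset.sum_apply] using measure_ge_le_exp_mul_mgf (3 * M) zero_le_one
          (hindep.iIndepFun_indicator.integrable_exp_mul_sum hmeas fun i _ => hexp i)
    _ ≤ Real.exp (-1 * (3 * M)) * ∏ i, Real.exp (μ.real (A i) * (Real.exp 1 - 1)) := by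
        rw [hindep.iIndepFun_indicator.mgf_sum hmeas]
        gcongr with i
        exacts [fun i _ => mgf_nonneg, mgf_indicator_one_le (hA i) 1]
    _ = Real.exp ((∑ i, μ.real (A i)) * (Real.exp 1 - 1) - 3 * M) := by
        rw [← Real.exp_sum, ← Real.exp_add, ← Finset.sum_mul]
        ring_nf
    _ ≤ Real.exp (M * (3 - 1) - 3 * M) := by
        gcongr
        · linarith [Real.add_one_le_exp 1]
        · exact Real.exp_one_lt_three.le
    _ = Real.exp (-M) := by ring_nf

theorem iIndepSet_preimage_eval_pi [Fintype ι] {E : ι → Type*} [∀ i, MeasurableSpace (E i)]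
    {ν : ∀ i, Measure (E i)} [∀ i, IsProbabilityMeasure (ν i)] {B : ∀ i, Set (E i)}
    (hB : ∀ i, MeasurableSet (B i)) :
    iIndepSet (fun i => (Function.eval i ⁻¹' B i : Set (∀ i, E i))) (Measure.pi ν) := by
  rw [iIndepSet_iff_meas_biInter fun i => measurable_pi_apply i (hB i)]
  exact fun s => (iIndepFun_pi fun i => (measurable_id (α := E i)).aemeasurable
    (μ := ν i)).measure_inter_preimage_eq_mul s fun i _ => hB i

theorem measureReal_pi_le_sum_indicator_le_exp_neg [Fintype ι] {E : ι → Type*}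
    [∀ i, MeasurableSpace (E i)] {ν : ∀ i, Measure (E i)} [∀ i, IsProbabilityMeasure (ν i)]
    {B : ∀ i, Set (E i)} (hB : ∀ i, MeasurableSet (B i)) {M : ℝ}
    (hM : ∑ i, (ν i).real (B i) ≤ M) :
    (Measure.pi ν).real {x | 3 * M ≤ ∑ i, (B i).indicator (fun _ => 1) (x i)} ≤ Real.exp (-M) := by
  refine measureReal_le_sum_indicator_le_exp_neg (fun i => measurable_pi_apply i (hB i))
    (iIndepSet_preimage_eval_pi hB) (le_of_eq_of_le (Finset.sum_congr rfl fun i _ => ?_) hM)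
  exact (measurePreserving_eval ν i).measureReal_preimage (hB i).nullMeasurableSet

end Chernoff

section Laws

variable {N ℓ m : ℕ}

theorem measureReal_uniformOfFinset {α : Type*} [MeasurableSpace α] {s : Finset α}
    (hs : s.Nonempty) {t : Set α} [DecidablePred (· ∈ t)] (ht : MeasurableSet t) :
    (PMF.uniformOfFinset s hs).toMeasure.real t = (s.filter (· ∈ t)).card / s.card := by
  rw [Measure.real, PMF.toMeasure_uniformOfFinset_apply _ _ ht, ENNReal.toReal_div,
    ENNReal.toReal_natCast, ENNReal.toReal_natCast]
  congr!

theorem argonALaw_sameLayer_le {v : ℕ} (hℓ : 0 < ℓ) (hv : ℓ ≤ v) :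
    (argonALaw v).toMeasure.real {j | j / ℓ = v / ℓ} ≤ ℓ / v := by
  unfold argonALaw
  split_ifs with h
  · have hv₃ : 3 ≤ v := by
      have := Finset.nonempty_Icc.1 h
      omega
    have hsub : ((Finset.Icc 1 (v - 2)).filter fun j => j / ℓ = v / ℓ) ⊆
        Finset.Ico (ℓ * (v / ℓ)) (v - 1) := by
      intro j hj
      obtain ⟨hj, hdiv⟩ := Finset.mem_filter.1 hj
      have := (Finset.mem_Icc.1 hj).2
      exact Finset.mem_Ico.2 ⟨hdiv ▸ Nat.mul_div_le j ℓ, by omega⟩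
    have hcard : ((Finset.Icc 1 (v - 2)).filter fun j => j / ℓ = v / ℓ).card ≤ ℓ - 2 := by
      have hle := Finset.card_le_card hsub
      rw [Nat.card_Ico] at hle
      have := Nat.div_add_mod v ℓ
      have := Nat.mod_lt v hℓ
      omega
    have hmul : (ℓ - 2) * v ≤ ℓ * (v - 2) := by
      rw [Nat.sub_mul, Nat.mul_sub]
      omega
    rw [measureReal_uniformOfFinset _ .of_discrete, Nat.card_Icc, Nat.add_sub_cancel,
      div_le_div_iff₀ (Nat.cast_pos.2 (by omega)) (Nat.cast_pos.2 (by omega))]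
    exact_mod_cast (Nat.mul_le_mul_right v hcard).trans hmul
  · have hzero : 0 ∉ {j | j / ℓ = v / ℓ} := by
      simpa only [Set.mem_ofPred_eq, Nat.zero_div] using (Nat.div_pos hv hℓ).ne
    rw [Measure.real, PMF.toMeasure_pure_apply _ _ .of_discrete, if_neg hzero,
      ENNReal.toReal_zero]
    positivity

theorem mul_le_of_ceil_div_eq {v : ℕ} (hℓ : 0 < ℓ) {z : ℝ} (hz : z ≤ 1)
    (h : ⌈(v : ℝ) * (1 - z)⌉₊ / ℓ = v / ℓ) : v * z ≤ ℓ := by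
  have hceil : (⌈(v : ℝ) * (1 - z)⌉₊ : ℝ) < v * (1 - z) + 1 :=
    Nat.ceil_lt_add_one (mul_nonneg v.cast_nonneg (sub_nonneg.2 hz))
  have hlayer : v + 1 ≤ ⌈(v : ℝ) * (1 - z)⌉₊ + ℓ := by
    have := Nat.div_add_mod v ℓ
    have := Nat.mod_lt v hℓ
    have := h ▸ Nat.mul_div_le ⌈(v : ℝ) * (1 - z)⌉₊ ℓ
    omega
  have hlayer' : (v : ℝ) + 1 ≤ ⌈(v : ℝ) * (1 - z)⌉₊ + ℓ := by exact_mod_cast hlayer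
  linarith

-- `argonBLaw` is defined with `x` in `ℝ`: its uniform law on `Finset.Icc 1 N` is itself mapped to
-- `ℝ` by the cast.
theorem argonBLaw_eq_map (v : Node N) :
    argonBLaw v = (PMF.uniformOfFinset (Finset.Icc 1 N) (Finset.nonempty_def.2 ⟨v, v.2⟩)).map
      fun x : ℕ => ⌈(v : ℝ) * (1 - (x : ℝ) ^ 2 / (N : ℝ) ^ 2)⌉₊ :=
  PMF.map_comp (fun x : ℕ => (x : ℝ)) _ fun x : ℝ => ⌈(v : ℝ) * (1 - x ^ 2 / (N : ℝ) ^ 2)⌉₊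

theorem argonBLaw_sameLayer_le (hℓ : 0 < ℓ) (v : Node N) :
    (argonBLaw v).toMeasure.real {j | j / ℓ = (v : ℕ) / ℓ} ≤ √(ℓ / v) := by
  obtain ⟨hv₁, hvN⟩ := Finset.mem_Icc.1 v.2
  have hv₀ : (0 : ℝ) < v := Nat.cast_pos.2 hv₁
  have hN₀ : (0 : ℝ) < N := Nat.cast_pos.2 (hv₁.trans hvN)
  classical
  set g : ℕ → ℕ := fun x => ⌈(v : ℝ) * (1 - (x : ℝ) ^ 2 / (N : ℝ) ^ 2)⌉₊
  have hsub : ((Finset.Icc 1 N).filter fun x => x ∈ g ⁻¹' {j | j / ℓ = (v : ℕ) / ℓ}) ⊆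
      Finset.Icc 1 ⌊√(ℓ / v) * N⌋₊ := by
    intro x hx
    obtain ⟨hx, hlayer⟩ := Finset.mem_filter.1 hx
    obtain ⟨hx₁, hxN⟩ := Finset.mem_Icc.1 hx
    have hz : (x : ℝ) ^ 2 / (N : ℝ) ^ 2 ≤ 1 := by
      rw [div_le_one₀ (by positivity)]
      gcongr
    have hsq : (v : ℝ) * ((x : ℝ) ^ 2 / (N : ℝ) ^ 2) ≤ ℓ := mul_le_of_ceil_div_eq hℓ hz hlayer
    refine Finset.mem_Icc.2 ⟨hx₁, Nat.le_floor ?_⟩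
    rw [← div_le_iff₀ hN₀]
    refine Real.le_sqrt_of_sq_le ?_
    rwa [div_pow, le_div_iff₀' hv₀]
  rw [argonBLaw_eq_map, Measure.real,
    PMF.toMeasure_map_apply _ _ _ measurable_from_top .of_discrete, ← Measure.real,
    measureReal_uniformOfFinset _ .of_discrete, Nat.card_Icc, Nat.add_sub_cancel, div_le_iff₀ hN₀]
  calc _ ≤ ((Finset.Icc 1 ⌊√(ℓ / v) * N⌋₊).card : ℝ) :=
        Nat.cast_le.2 (Finset.card_le_card hsub)
    _ ≤ √(ℓ / v) * N := by
        rw [Nat.card_Icc, Nat.add_sub_cancel]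
        exact Nat.floor_le (by positivity)

theorem sum_Ioc_inv_le_log {n : ℕ} (hℓ : 0 < ℓ) (hn : ℓ ≤ n) :
    ∑ v ∈ Finset.Ioc ℓ n, (v : ℝ)⁻¹ ≤ Real.log (n / ℓ) := by
  induction n, hn using Nat.le_induction with
  | base => simp
  | succ n hn ih =>
    have hn₀ : (0 : ℝ) < n := Nat.cast_pos.2 (hℓ.trans_le hn)
    have : (0 : ℝ) < ℓ := Nat.cast_pos.2 hℓ
    calc ∑ v ∈ Finset.Ioc ℓ (n + 1), (v : ℝ)⁻¹
        ≤ Real.log (n / ℓ) + ((n + 1 : ℕ) : ℝ)⁻¹ := by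
          rw [Finset.sum_Ioc_succ_top hn]
          exact add_le_add_left ih _
      _ = Real.log (n / ℓ) + (1 - (((n + 1 : ℕ) : ℝ) / n)⁻¹) := by
          push_cast
          field_simp
          ring
      _ ≤ Real.log (n / ℓ) + Real.log ((n + 1 : ℕ) / n) :=
          add_le_add_right (Real.one_sub_inv_le_log_of_pos (by positivity)) _
      _ = Real.log ((n + 1 : ℕ) / ℓ) := by
          rw [← Real.log_mul (by positivity) (by positivity)]
          congr 1
          field_simp

theorem sum_Icc_le_mul_one_add_log {f : ℕ → ℝ} {n : ℕ} (hℓ : 0 < ℓ)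
    (hn : n ≤ m * ℓ) (hf₁ : ∀ v, f v ≤ 1) (hf : ∀ v, ℓ ≤ v → f v ≤ ℓ / v) :
    ∑ v ∈ Finset.Icc 1 n, f v ≤ ℓ * (1 + Real.log m) := by
  have hsum₁ (k : ℕ) : ∑ v ∈ Finset.Ioc 0 k, f v ≤ k := by
    simpa using Finset.sum_le_card_nsmul (Finset.Ioc 0 k) f 1 fun v _ => hf₁ v
  have hlog : 0 ≤ Real.log m := Real.log_natCast_nonneg m
  have hℓ₀ : (0 : ℝ) < ℓ := Nat.cast_pos.2 hℓ
  rw [show Finset.Icc 1 n = Finset.Ioc 0 n from Finset.Icc_add_one_left_eq_Ioc 0 n]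
  rcases le_total n ℓ with hnℓ | hnℓ
  · calc ∑ v ∈ Finset.Ioc 0 n, f v ≤ n := hsum₁ n
      _ ≤ ℓ * 1 := by rw [mul_one]; exact Nat.cast_le.2 hnℓ
      _ ≤ ℓ * (1 + Real.log m) := by gcongr; linarith
  · have hratio : (n : ℝ) / ℓ ≤ m := by
      rw [div_le_iff₀ hℓ₀]
      exact_mod_cast hn
    have hn₀ : (0 : ℝ) < n := Nat.cast_pos.2 (hℓ.trans_le hnℓ)
    calc ∑ v ∈ Finset.Ioc 0 n, f v
        = ∑ v ∈ Finset.Ioc 0 ℓ, f v + ∑ v ∈ Finset.Ioc ℓ n, f v :=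
          (Finset.sum_Ioc_consecutive f ℓ.zero_le hnℓ).symm
      _ ≤ ℓ + ∑ v ∈ Finset.Ioc ℓ n, (ℓ : ℝ) / v := by
          gcongr with v hv
          exacts [hsum₁ ℓ, hf v (Finset.mem_Ioc.1 hv).1.le]
      _ = ℓ * (1 + ∑ v ∈ Finset.Ioc ℓ n, (v : ℝ)⁻¹) := by
          simp only [div_eq_mul_inv, ← Finset.mul_sum, mul_add, mul_one]
      _ ≤ ℓ * (1 + Real.log (n / ℓ)) := by gcongr; exact sum_Ioc_inv_le_log hℓ hnℓ
      _ ≤ ℓ * (1 + Real.log m) := by gcongr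

theorem sum_Icc_inv_sqrt_le (n : ℕ) : ∑ v ∈ Finset.Icc 1 n, (√(v : ℝ))⁻¹ ≤ 2 * √n := by
  induction n with
  | zero => simp
  | succ n ih =>
    have hstep : (√((n : ℝ) + 1))⁻¹ ≤ 2 * √((n : ℝ) + 1) - 2 * √n := by
      have h₀ : 0 < √((n : ℝ) + 1) := Real.sqrt_pos.2 (by positivity)
      have h₁ := Real.sq_sqrt (show (0 : ℝ) ≤ n by positivity)
      have h₂ := Real.sq_sqrt (show (0 : ℝ) ≤ n + 1 by positivity)
      rw [inv_le_iff_one_le_mul₀ h₀]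
      nlinarith [sq_nonneg (√((n : ℝ) + 1) - √n)]
    rw [Finset.sum_Icc_succ_top (by omega)]
    push_cast
    linarith

theorem natCast_div_add_one_le {q : ℕ} (hq : 0 < q) (hqN : q ≤ N) :
    ((N / q + 1 : ℕ) : ℝ) ≤ 2 * (N / q) := by
  have hdiv : ((N / q : ℕ) : ℝ) ≤ N / q := Nat.cast_div_le
  have hone : (1 : ℝ) ≤ N / q := (one_le_div₀ (Nat.cast_pos.2 hq)).2 (Nat.cast_le.2 hqN)
  push_cast
  linarith

theorem sum_argonALaw_sameLayer_le (hm : 0 < m) (hmN : m ≤ N) :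
    ∑ v : Node N, (argonALaw v).toMeasure.real {j | j / (N / m + 1) = (v : ℕ) / (N / m + 1)} ≤
      2 * (N / m) * (1 + Real.log m) := by
  rw [Finset.sum_coe_sort (Finset.Icc 1 N) fun v : ℕ =>
    (argonALaw v).toMeasure.real {j | j / (N / m + 1) = v / (N / m + 1)}]
  refine (sum_Icc_le_mul_one_add_log (Nat.succ_pos _) (Nat.lt_mul_div_succ N hm).le
    (fun v => measureReal_le_one) fun v => argonALaw_sameLayer_le (Nat.succ_pos _)).trans ?_
  have := Real.log_natCast_nonneg m
  gcongr
  exact natCast_div_add_one_le hm hmN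

theorem sum_argonBLaw_sameLayer_le (hm : 0 < m) (hmN : m ^ 2 ≤ N) :
    ∑ v : Node N, (argonBLaw v).toMeasure.real
      {j | j / (N / m ^ 2 + 1) = (v : ℕ) / (N / m ^ 2 + 1)} ≤ 3 * (N / m) := by
  set ℓ := N / m ^ 2 + 1
  have hℓ : (ℓ : ℝ) ≤ 2 * (N / m ^ 2) := by
    exact_mod_cast natCast_div_add_one_le (pow_pos hm 2) hmN
  calc ∑ v : Node N, (argonBLaw v).toMeasure.real {j | j / ℓ = (v : ℕ) / ℓ}
      ≤ ∑ v : Node N, √((ℓ : ℝ) / v) :=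
        Finset.sum_le_sum fun v _ => argonBLaw_sameLayer_le (Nat.succ_pos _) v
    _ = √ℓ * ∑ v ∈ Finset.Icc 1 N, (√(v : ℝ))⁻¹ := by
        rw [Finset.sum_coe_sort (Finset.Icc 1 N) fun v : ℕ => √((ℓ : ℝ) / v), Finset.mul_sum]
        refine Finset.sum_congr rfl fun v _ => ?_
        rw [Real.sqrt_div ℓ.cast_nonneg, div_eq_mul_inv]
    _ ≤ √ℓ * (2 * √N) := by gcongr; exact sum_Icc_inv_sqrt_le N
    _ = 2 * √(ℓ * N) := by rw [Real.sqrt_mul ℓ.cast_nonneg]; ring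
    _ ≤ 2 * (3 / 2 * (N / m)) := by
        gcongr
        rw [Real.sqrt_le_left (by positivity)]
        calc (ℓ : ℝ) * N ≤ 2 * (N / m ^ 2) * N := by gcongr
          _ = 2 * (N / m) ^ 2 := by ring
          _ ≤ (3 / 2 * (N / m)) ^ 2 := by nlinarith [sq_nonneg ((N : ℝ) / m)]
    _ = 3 * (N / m) := by ring

end Laws
section Parameters

variable {N m : ℕ}

theorem sq_le_four_pow (m : ℕ) : m ^ 2 ≤ 4 ^ m :=
  calc m ^ 2 ≤ (2 ^ m) ^ 2 := Nat.pow_le_pow_left Nat.lt_two_pow_self.le 2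
    _ = 4 ^ m := by rw [← pow_mul, mul_comm, pow_mul]; rfl

theorem sqrt_le_div (hm : 0 < m) (h : m ^ 2 ≤ N) : √(N : ℝ) ≤ N / m := by
  rw [le_div_iff₀ (Nat.cast_pos.2 hm)]
  calc √(N : ℝ) * m ≤ √N * √N := by
        gcongr
        exact Real.le_sqrt_of_sq_le (by exact_mod_cast h)
    _ = N := Real.mul_self_sqrt N.cast_nonneg

theorem one_sub_exp_le_measureReal_spaceTimeComplexity_le (p : Node N → PMF ℕ) {ℓ q : ℕ}
    (hm : 0 < m) (hq : N < q * ℓ) (hN : 16 ^ (q * m) ≤ N) {M : ℝ}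
    (hM : ∑ v : Node N, (p v).toMeasure.real {j | j / ℓ = (v : ℕ) / ℓ} ≤ M) (hmM : N / m ≤ M) :
    1 - Real.exp (-√N) ≤ (Measure.pi fun v => (p v).toMeasure).real
      {r | (spaceTimeComplexity (argonGraph r) : ℝ≥0∞) ≤ ENNReal.ofReal (240 * N * M)} := by
  have hmq : m ≤ q * m := Nat.le_mul_of_pos_left m (Nat.pos_of_mul_pos_right (Nat.zero_lt_of_lt hq))
  have hmN : m ^ 2 ≤ N :=
    calc m ^ 2 ≤ 4 ^ m := sq_le_four_pow m
      _ ≤ 16 ^ m := Nat.pow_le_pow_left (by norm_num) m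
      _ ≤ 16 ^ (q * m) := Nat.pow_le_pow_right (by norm_num) hmq
      _ ≤ N := hN
  set T : Set (Node N → ℕ) := {r | 3 * M ≤
    ∑ v : Node N, {j | j / ℓ = (v : ℕ) / ℓ}.indicator (fun _ => 1) (r v)}
  calc 1 - Real.exp (-√N)
      ≤ 1 - Real.exp (-M) := by
        gcongr
        exact (sqrt_le_div hm hmN).trans hmM
    _ ≤ 1 - (Measure.pi fun v => (p v).toMeasure).real T := by
        gcongr
        exact measureReal_pi_le_sum_indicator_le_exp_neg (fun _ => .of_discrete) hM
    _ = (Measure.pi fun v => (p v).toMeasure).real Tᶜ :=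
        (probReal_compl_eq_one_sub .of_discrete).symm
    _ ≤ _ := measureReal_mono fun r hr => ?_
  have hcard : ((sameLayer r ℓ).card : ℝ) < 3 * M := by
    rw [sameLayer, Finset.card_filter, Nat.cast_sum]
    refine (Finset.sum_congr rfl fun v _ => ?_).trans_lt (not_le.1 hr)
    simp only [Set.indicator_apply, Set.mem_ofPred_eq, Nat.cast_ite, Nat.cast_one, Nat.cast_zero]
  refine (spaceTimeComplexity_argonGraph_le_card_sameLayer r hm hq hN).trans
    (ENNReal.ofReal_le_ofReal ?_)
  calc (24 * N * ((sameLayer r ℓ).card + 7 * (N / m)) : ℝ) ≤ 24 * N * (3 * M + 7 * M) := by gcongr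
    _ = 240 * N * M := by ring

theorem withHighProbability_of_eventually {Ω : ℕ → Type*} [∀ N, MeasurableSpace (Ω N)]
    {μ : ∀ N, Measure (Ω N)} {E : ∀ N, Set (Ω N)}
    (h : ∀ᶠ N : ℕ in atTop, 1 - Real.exp (-√N) ≤ (μ N).real (E N)) :
    WithHighProbability μ E := by
  intro c _
  have hexp := ((isLittleO_exp_neg_mul_rpow_atTop one_pos (-(2 * c))).bound one_pos)
  have hsqrt : Tendsto (fun N : ℕ => √(N : ℝ)) atTop atTop :=
    Real.tendsto_sqrt_atTop.comp tendsto_natCast_atTop_atTop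
  filter_upwards [h, hsqrt.eventually hexp] with N hN hNc
  refine le_trans (sub_le_sub_left ?_ 1) hN
  calc Real.exp (-√N) ≤ √(N : ℝ) ^ (-(2 * c)) := by
        simpa [abs_of_nonneg (Real.rpow_nonneg (Real.sqrt_nonneg _) _)] using hNc
    _ = (N : ℝ) ^ (-c) := by
        rw [Real.sqrt_eq_rpow, ← Real.rpow_mul N.cast_nonneg]
        ring_nf

theorem natCast_le_logb_two_iff (hN : 0 < N) : (m : ℝ) ≤ Real.logb 2 N ↔ 2 ^ m ≤ N := by
  rw [Real.le_logb_iff_rpow_le one_lt_two (Nat.cast_pos.2 hN), Real.rpow_natCast]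
  norm_cast

theorem four_le_logb_two (hN : 16 ≤ N) : 4 ≤ Real.logb 2 N := by
  exact_mod_cast (natCast_le_logb_two_iff (m := 4) (by omega)).2 hN

theorem exists_sixteen_pow_pow_le {k : ℕ} (hk : k ≠ 0) (hN : 16 ≤ N) :
    ∃ m : ℕ, 0 < m ∧ 16 ^ m ^ k ≤ N ∧ Real.logb 2 N ^ (1 / k : ℝ) ≤ 8 * m := by
  set y : ℝ := Real.logb 2 N / 4
  have hy : 1 ≤ y := (one_le_div₀ four_pos).2 (four_le_logb_two hN)
  set m := ⌊y ^ (1 / k : ℝ)⌋₊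
  have hm : 0 < m := Nat.floor_pos.2 (Real.one_le_rpow hy (by positivity))
  refine ⟨m, hm, ?_, ?_⟩
  · have hpow : (m : ℝ) ^ k ≤ y :=
      calc (m : ℝ) ^ k ≤ (y ^ (1 / k : ℝ)) ^ k := by
            gcongr
            exact Nat.floor_le (by positivity)
        _ = y := by rw [one_div, Real.rpow_inv_natCast_pow (by positivity) hk]
    rw [show 16 = 2 ^ 4 from rfl, ← pow_mul, ← natCast_le_logb_two_iff (by omega)]
    exact_mod_cast (le_div_iff₀' four_pos).1 hpow
  · calc Real.logb 2 N ^ (1 / k : ℝ) = 4 ^ (1 / k : ℝ) * y ^ (1 / k : ℝ) := by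
          rw [← Real.mul_rpow (by norm_num) (by positivity), mul_div_cancel₀ _ four_ne_zero]
      _ ≤ 4 ^ (1 : ℝ) * (m + 1) := by
          gcongr
          · norm_num
          · exact div_le_self zero_le_one (Nat.one_le_cast.2 (Nat.one_le_iff_ne_zero.2 hk))
          · exact (Nat.lt_floor_add_one _).le
      _ ≤ 8 * m := by
          have : (1 : ℝ) ≤ m := Nat.one_le_cast.2 hm
          rw [Real.rpow_one]
          linarith

theorem div_le_mul_div_of_le_mul {a b c n : ℝ} (ha : 0 < a) (hb : 0 < b) (hn : 0 ≤ n)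
    (h : b ≤ c * a) : n / a ≤ c * n / b := by
  rw [div_le_div_iff₀ ha hb]
  calc n * b ≤ n * (c * a) := by gcongr
    _ = c * n * a := by ring

theorem withHighProbability_argonA : WithHighProbability argonA fun N =>
    {r | (spaceTimeComplexity (argonGraph r) : ℝ≥0∞) ≤ ENNReal.ofReal
      (7680 * ((N : ℝ) ^ 2 * Real.logb 2 (Real.logb 2 N) / √(Real.logb 2 N)))} := by
  refine withHighProbability_of_eventually ?_
  filter_upwards [eventually_ge_atTop 16] with N hN
  obtain ⟨m, hm, hmN, hroot⟩ := exists_sixteen_pow_pow_le two_ne_zero hN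
  have hm₀ : (0 : ℝ) < m := Nat.cast_pos.2 hm
  set x := Real.logb 2 N
  have hmsq : m ^ 2 ≤ N := (Nat.lt_pow_self (by norm_num)).le.trans hmN
  have hx : 4 ≤ x := four_le_logb_two hN
  have hmx : (m : ℝ) ≤ x := (natCast_le_logb_two_iff (by omega)).2 <|
    calc 2 ^ m ≤ 16 ^ m := Nat.pow_le_pow_left (by norm_num) m
      _ ≤ 16 ^ m ^ 2 := Nat.pow_le_pow_right (by norm_num) (Nat.le_self_pow two_ne_zero m)
      _ ≤ N := hmN
  have hloglog : 1 ≤ Real.logb 2 x := by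
    rw [Real.le_logb_iff_rpow_le one_lt_two (by positivity), Real.rpow_one]
    linarith
  have hlog : Real.log m ≤ Real.logb 2 x :=
    (Real.log_le_log hm₀ hmx).trans
      (le_div_self (Real.log_nonneg (by linarith)) (Real.log_pos one_lt_two)
        (Real.log_two_lt_d9.le.trans (by norm_num)))
  have hlog₀ : 0 ≤ Real.log m := Real.log_natCast_nonneg m
  refine (one_sub_exp_le_measureReal_spaceTimeComplexity_le (fun v : Node N => argonALaw v) hm
    (Nat.lt_mul_div_succ N hm) (by rwa [← sq])
    (sum_argonALaw_sameLayer_le hm ((Nat.le_self_pow two_ne_zero m).trans hmsq)) ?_).trans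
    (measureReal_mono fun r hr => hr.trans (ENNReal.ofReal_le_ofReal ?_))
  · nlinarith [show 0 ≤ (N : ℝ) / m by positivity]
  · calc 240 * N * (2 * (N / m) * (1 + Real.log m))
        ≤ 240 * N * (2 * (8 * N / √x) * (2 * Real.logb 2 x)) := by
          gcongr ?_ * (2 * ?_ * ?_)
          · rw [Nat.cast_ofNat, ← Real.sqrt_eq_rpow] at hroot
            exact div_le_mul_div_of_le_mul hm₀ (by positivity) N.cast_nonneg hroot
          · linarith
      _ = 7680 * ((N : ℝ) ^ 2 * Real.logb 2 x / √x) := by ring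

theorem withHighProbability_argonB : WithHighProbability argonB fun N =>
    {r | (spaceTimeComplexity (argonGraph r) : ℝ≥0∞) ≤ ENNReal.ofReal
      (5760 * ((N : ℝ) ^ 2 / (Real.logb 2 N) ^ (1 / 3 : ℝ)))} := by
  refine withHighProbability_of_eventually ?_
  filter_upwards [eventually_ge_atTop 16] with N hN
  obtain ⟨m, hm, hmN, hroot⟩ := exists_sixteen_pow_pow_le three_ne_zero hN
  have hm₀ : (0 : ℝ) < m := Nat.cast_pos.2 hm
  have hlog : 0 < Real.logb 2 N := Real.logb_pos one_lt_two (Nat.one_lt_cast.2 (by omega))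
  have hmsq : m ^ 2 ≤ N :=
    (Nat.pow_le_pow_right hm (by norm_num)).trans ((Nat.lt_pow_self (by norm_num)).le.trans hmN)
  refine (one_sub_exp_le_measureReal_spaceTimeComplexity_le argonBLaw hm
    (Nat.lt_mul_div_succ N (pow_pos hm 2)) (by rwa [← pow_succ])
    (sum_argonBLaw_sameLayer_le hm hmsq) ?_).trans
    (measureReal_mono fun r hr => hr.trans (ENNReal.ofReal_le_ofReal ?_))
  · exact le_mul_of_one_le_left (by positivity) (by norm_num)
  · calc 240 * N * (3 * (N / m)) ≤ 240 * N * (3 * (8 * N / Real.logb 2 N ^ (1 / 3 : ℝ))) := by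
          gcongr 240 * N * (3 * ?_)
          exact div_le_mul_div_of_le_mul hm₀ (by positivity) N.cast_nonneg hroot
      _ = 5760 * ((N : ℝ) ^ 2 / Real.logb 2 N ^ (1 / 3 : ℝ)) := by ring

end Parameters

end QuantumPebbling

theorem mainTheorem4 :
    (∃ C : ℝ, 0 < C ∧
      QuantumPebbling.WithHighProbability QuantumPebbling.argonA fun N =>
        {r | (QuantumPebbling.spaceTimeComplexity (QuantumPebbling.argonGraph r) : ℝ≥0∞) ≤
          ENNReal.ofReal
            (C * ((N : ℝ) ^ 2 * Real.logb 2 (Real.logb 2 N) / √(Real.logb 2 N)))}) ∧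
    (∃ C : ℝ, 0 < C ∧
      QuantumPebbling.WithHighProbability QuantumPebbling.argonB fun N =>
        {r | (QuantumPebbling.spaceTimeComplexity (QuantumPebbling.argonGraph r) : ℝ≥0∞) ≤
          ENNReal.ofReal
            (C * ((N : ℝ) ^ 2 / (Real.logb 2 N) ^ (1 / 3 : ℝ)))}) :=
  ⟨⟨7680, by norm_num, QuantumPebbling.withHighProbability_argonA⟩,
    ⟨5760, by norm_num, QuantumPebbling.withHighProbability_argonB⟩⟩
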